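/- **Theorem 3.3.** Let $d\in\{2,3\}$ and let $\Omega\subset\mathbb R^d$ be a bounded open set (for instance a bounded Lipschitz domain). Let $H^1_0(\Omega)$ be the closure of $C_c^\infty(\Omega)$ in $H^1(\Omega)$, let $\|\cdot\|_{0,2}$ be the norm of $L^2(\Omega)$, and write $(w,v)=\int_\Omega wv\,dx$. Assume: * (A1) $D\in L^\infty(\Omega;\mathbb R^{d\times d})$ and, for constants $m,M>0$ and almost every $x\in\Omega$, $m|\xi|^2\le \xi^TD(x)\xi\le M|\xi|^2$ for all $\xi\in\mathbb R^d$. * (A2) $f\in L^2(\Omega)$. * (A3) $b:\Omega\times\mathbb R\to\mathbb R$ is such that $b(\cdot,\xi)$ is measurable for every $\xi\in\mathbb R$, and for every $x\in\Omega$ the function $b(x,\cdot)$ is $C^\infty$ with $\partial_\xi b(x,\xi)\ge 0$ for all $\xi$ and $b(x,0)=0$. * (A4) There are an integer $n$ and a constant $K>0$, with $1\le n<\infty$ if $d=2$ and $1\le n\le\frac{d+2}{d-2}=5$ if $d=3$, such that $|\partial_\xi^n b(x,\xi)|\le K$ for all $x\in\Omega$ and $\xi\in\mathbb R$. Moreover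 $\partial_\xi^k b(\cdot,0)\in L^\infty(\Omega)$ for $1\le k\le n-1$ (this is automatic if $b$ does not depend on $x$; equivalently, the derivatives of orders $1,\dots,n-1$ are bounded on $\Omega\times[-r,r]$ for every $r>0$, up to a null set of $x$). Put $a(u,v)=\int_\Omega D\nabla u\cdot\nabla v\,dx$ and write $b(u)$ for $x\mapsto b(x,u(x))$. Then there is a constant $C_L$, depending only on $\Omega,d,m,n,b,f$, with the following property. Let $D$ satisfy (A1) with the given $m$ (and any $M$), and let $u\in H^1_0(\Omega)$ satisfy $$a(u,v)+(b(u),v)=(f,v)\qquad\forall v\in H^1_0(\Omega).$$ Let $\mathcal T_h$ be any triangulation of $\Omega$ (a finite conforming simplicial mesh whose union is $\overline\Omega$; no angle, shape-regularity or quasi-uniformity condition is needed), let $k\ge1$, let $V_h=\{v\in H^1_0(\Omega): v|_T\in\mathbb P_k(T)\ \forall T\in\mathcal T_h\}$, and let $u_h\in V_h$ satisfy $$a(u_h,v)+(b(u_h),v)=(f,v)\qquad\forall v\in V_h.$$ Then for all $v\in H^1_0(\Omega)$ the function $(b(u)-b(u_h))v$ is integrable on $\Omega$ and $$(b(u)-b(u_h),v)\le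 C_L\,\|\nabla(u-u_h)\|_{0,2}\,\|\nabla v\|_{0,2}.$$ In particular $C_L$ is independent of $h$, of the mesh and of the polynomial degree $k$. -/

import Mathlib

open MeasureTheory
open scoped Matrix ContDiff

namespace Semilinear

/-! ### Sobolev spaces through weak derivatives -/

/-- Smooth functions with compact support contained in `Ω`. -/
def IsTestFunction {d : ℕ} (Ω : Set (EuclideanSpace ℝ (Fin d)))
    (φ : EuclideanSpace ℝ (Fin d) → ℝ) : Prop :=
  ContDiff ℝ ∞ φ ∧ HasCompactSupport φ ∧ tsupport φ ⊆ Ω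

/-- `G` is a weak gradient of `u` in `Ω`: both are locally integrable in `Ω` and
`∫_Ω u ∇φ = - ∫_Ω φ G` for all test functions `φ` (an identity between vectors). -/
structure HasWeakGradient {d : ℕ} (Ω : Set (EuclideanSpace ℝ (Fin d)))
    (u : EuclideanSpace ℝ (Fin d) → ℝ)
    (G : EuclideanSpace ℝ (Fin d) → EuclideanSpace ℝ (Fin d)) : Prop where
  locallyIntegrableOn : LocallyIntegrableOn u Ω volume
  locallyIntegrableOn_grad : LocallyIntegrableOn G Ω volume
  integral_eq : ∀ φ : EuclideanSpace ℝ (Fin d) → ℝ, IsTestFunction Ω φ →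
    ∫ x in Ω, u x • gradient φ x = - ∫ x in Ω, φ x • G x

/-- Weak gradients in an open set are unique up to a null set. -/
theorem HasWeakGradient.ae_eq {d : ℕ} {Ω : Set (EuclideanSpace ℝ (Fin d))} (hΩ : IsOpen Ω)
    {u : EuclideanSpace ℝ (Fin d) → ℝ}
    {G H : EuclideanSpace ℝ (Fin d) → EuclideanSpace ℝ (Fin d)}
    (hG : HasWeakGradient Ω u G) (hH : HasWeakGradient Ω u H) :
    G =ᵐ[volume.restrict Ω] H := by
  have key := hΩ.ae_eq_zero_of_integral_contDiff_smul_eq_zero (μ := volume) (f := G - H)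
    (hG.locallyIntegrableOn_grad.sub hH.locallyIntegrableOn_grad) (by
      intro φ hφ hc hs
      have hi : ∀ F : EuclideanSpace ℝ (Fin d) → EuclideanSpace ℝ (Fin d),
          LocallyIntegrableOn F Ω volume → IntegrableOn (fun x => φ x • F x) Ω volume := by
        intro F hF
        have h1 : IntegrableOn F (tsupport φ) volume :=
          hF.integrableOn_compact_subset hs hc
        have h2 : IntegrableOn (fun x => φ x • F x) (tsupport φ) volume :=
          h1.continuousOn_smul hφ.continuous.continuousOn hc
        refine h2.of_forall_sdiff_eq_zero hΩ.measurableSet ?_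
        intro x hx
        simp [image_eq_zero_of_notMem_tsupport hx.2]
      have e : ∫ x in Ω, φ x • (G - H) x = 0 := by
        have e1 := hG.integral_eq φ ⟨hφ, hc, hs⟩
        have e2 := hH.integral_eq φ ⟨hφ, hc, hs⟩
        have : ∀ x, φ x • (G - H) x = φ x • G x - φ x • H x := fun x => by
          simp [smul_sub]
        simp only [this]
        rw [integral_sub (hi G hG.locallyIntegrableOn_grad) (hi H hH.locallyIntegrableOn_grad)]
        have e3 := neg_injective (e1.symm.trans e2)
        rw [e3, sub_self]
      rw [← e]
      refine (setIntegral_eq_integral_of_forall_compl_eq_zero ?_).symm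
      intro x hx
      have : x ∉ tsupport φ := fun h => hx (hs h)
      simp [image_eq_zero_of_notMem_tsupport this])
  rw [Filter.EventuallyEq, ae_restrict_iff' hΩ.measurableSet]
  filter_upwards [key] with x hx hxΩ
  exact sub_eq_zero.mp (hx hxΩ)

open Classical in
/-- The weak gradient `∇u` of `u` in `Ω` (a representative of it; `0` if there is none). -/
noncomputable def weakGrad {d : ℕ} (Ω : Set (EuclideanSpace ℝ (Fin d)))
    (u : EuclideanSpace ℝ (Fin d) → ℝ) :
    EuclideanSpace ℝ (Fin d) → EuclideanSpace ℝ (Fin d) :=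
  if h : ∃ G, HasWeakGradient Ω u G then h.choose else 0

/-- `u ∈ H¹(Ω)`. -/
def MemH1 {d : ℕ} (Ω : Set (EuclideanSpace ℝ (Fin d)))
    (u : EuclideanSpace ℝ (Fin d) → ℝ) : Prop :=
  MemLp u 2 (volume.restrict Ω) ∧
    ∃ G, HasWeakGradient Ω u G ∧ MemLp G 2 (volume.restrict Ω)

/-- `u ∈ H¹₀(Ω)`: the closure of the test functions in the norm of `H¹(Ω)`. -/
def MemH10 {d : ℕ} (Ω : Set (EuclideanSpace ℝ (Fin d)))
    (u : EuclideanSpace ℝ (Fin d) → ℝ) : Prop :=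
  MemH1 Ω u ∧ ∀ ε : ENNReal, 0 < ε → ∃ φ : EuclideanSpace ℝ (Fin d) → ℝ, IsTestFunction Ω φ ∧
    eLpNorm (fun x => u x - φ x) 2 (volume.restrict Ω) +
      eLpNorm (fun x => weakGrad Ω u x - gradient φ x) 2 (volume.restrict Ω) < ε

/-- The norm `‖∇u‖_{0,2}`. -/
noncomputable def gradNorm {d : ℕ} (Ω : Set (EuclideanSpace ℝ (Fin d)))
    (u : EuclideanSpace ℝ (Fin d) → ℝ) : ℝ :=
  (eLpNorm (weakGrad Ω u) 2 (volume.restrict Ω)).toReal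

/-! ### The semilinear problem -/

/-- `D ∈ L^∞(Ω)`, and `m |ξ|² ≤ ξᵀ D ξ ≤ M |ξ|²`. Symmetry of `D` is not required. -/
structure IsElliptic {d : ℕ} (Ω : Set (EuclideanSpace ℝ (Fin d)))
    (D : EuclideanSpace ℝ (Fin d) → Matrix (Fin d) (Fin d) ℝ) (m M : ℝ) : Prop where
  memLp_top : ∀ i j, MemLp (fun x => D x i j) ⊤ (volume.restrict Ω)
  bounds : ∀ᵐ x ∂(volume.restrict Ω), ∀ ξ : EuclideanSpace ℝ (Fin d),
    m * ‖ξ‖ ^ 2 ≤ ξ.ofLp ⬝ᵥ (D x *ᵥ ξ.ofLp) ∧ ξ.ofLp ⬝ᵥ (D x *ᵥ ξ.ofLp) ≤ M * ‖ξ‖ ^ 2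

/-- `b` is a Carathéodory function on `Ω × ℝ`, smooth and nondecreasing in the second variable,
with `b(x, 0) = 0`. -/
structure IsMonotoneNonlinearity {d : ℕ} (Ω : Set (EuclideanSpace ℝ (Fin d)))
    (b : EuclideanSpace ℝ (Fin d) → ℝ → ℝ) : Prop where
  aemeasurable : ∀ ξ : ℝ, AEMeasurable (fun x => b x ξ) (volume.restrict Ω)
  contDiff : ∀ x ∈ Ω, ContDiff ℝ ∞ (b x)
  deriv_nonneg : ∀ x ∈ Ω, ∀ ξ : ℝ, 0 ≤ deriv (b x) ξ
  map_zero : ∀ x ∈ Ω, b x 0 = 0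

/-- The growth condition of order `n`: the `n`-th derivative of `b` in the second variable is
bounded on `Ω × ℝ`, and the derivatives of orders `1, …, n - 1` at `ξ = 0` are essentially
bounded functions of `x ∈ Ω`. The second part holds by itself if `b` does not depend on `x`;
given the first part it says that these derivatives are bounded on `Ω × [-r, r]` for every `r`,
up to a null set of points `x`. -/
structure HasGrowth {d : ℕ} (Ω : Set (EuclideanSpace ℝ (Fin d)))
    (b : EuclideanSpace ℝ (Fin d) → ℝ → ℝ) (n : ℕ) : Prop where
  top_bound : ∃ K : ℝ, 0 < K ∧ ∀ x ∈ Ω, ∀ ξ : ℝ, |iteratedDeriv n (b x) ξ| ≤ K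
  lower_bound : ∀ k : ℕ, 1 ≤ k → k < n →
    ∃ B : ℝ, ∀ᵐ x ∂(volume.restrict Ω), |iteratedDeriv k (b x) 0| ≤ B

/-- `a(u, v) = ∫_Ω D ∇u · ∇v`. -/
noncomputable def energyForm {d : ℕ} (Ω : Set (EuclideanSpace ℝ (Fin d)))
    (D : EuclideanSpace ℝ (Fin d) → Matrix (Fin d) (Fin d) ℝ)
    (u v : EuclideanSpace ℝ (Fin d) → ℝ) : ℝ :=
  ∫ x in Ω, (D x *ᵥ (weakGrad Ω u x).ofLp) ⬝ᵥ (weakGrad Ω v x).ofLp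

/-- `a(u, v) + (b(u), v) = (f, v)` with a meaningful pairing `(b(u), v)`, for the test function
`v`. -/
def SatisfiesWeakEq {d : ℕ} (Ω : Set (EuclideanSpace ℝ (Fin d)))
    (D : EuclideanSpace ℝ (Fin d) → Matrix (Fin d) (Fin d) ℝ)
    (b : EuclideanSpace ℝ (Fin d) → ℝ → ℝ) (f u v : EuclideanSpace ℝ (Fin d) → ℝ) : Prop :=
  IntegrableOn (fun x => b x (u x) * v x) Ω volume ∧
    energyForm Ω D u v + ∫ x in Ω, b x (u x) * v x = ∫ x in Ω, f x * v x

/-- `u ∈ H¹₀(Ω)` is a weak solution of `-∇·(D ∇u) + b(x, u) = f` in `Ω`, `u = 0` on `∂Ω`. -/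
def IsWeakSolution {d : ℕ} (Ω : Set (EuclideanSpace ℝ (Fin d)))
    (D : EuclideanSpace ℝ (Fin d) → Matrix (Fin d) (Fin d) ℝ)
    (b : EuclideanSpace ℝ (Fin d) → ℝ → ℝ) (f u : EuclideanSpace ℝ (Fin d) → ℝ) : Prop :=
  MemH10 Ω u ∧ ∀ v, MemH10 Ω v → SatisfiesWeakEq Ω D b f u v

/-! ### Finite elements -/

/-- A triangulation of `Ω`: a finite simplicial complex that covers exactly the closure of `Ω` and
in which each simplex is a face of a `d`-dimensional one. No angle condition, shape regularity or
quasi-uniformity is required. -/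
structure IsTriangulation {d : ℕ} (Ω : Set (EuclideanSpace ℝ (Fin d)))
    (T : Geometry.SimplicialComplex ℝ (EuclideanSpace ℝ (Fin d))) : Prop where
  finite : T.faces.Finite
  space_eq : T.space = closure Ω
  pure : ∀ s ∈ T.faces, ∃ t ∈ T.faces, s ⊆ t ∧ t.card = d + 1

/-- The finite element space `V_h = {v ∈ H¹₀(Ω) : v|_τ ∈ P_k(τ) for all cells τ}`; a cell is a
`d`-dimensional simplex of the triangulation, given by its `d + 1` vertices. -/
def MemFE {d : ℕ} (Ω : Set (EuclideanSpace ℝ (Fin d)))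
    (T : Geometry.SimplicialComplex ℝ (EuclideanSpace ℝ (Fin d))) (k : ℕ)
    (v : EuclideanSpace ℝ (Fin d) → ℝ) : Prop :=
  MemH10 Ω v ∧ ∀ t ∈ T.faces, t.card = d + 1 →
    ∃ P : MvPolynomial (Fin d) ℝ, P.totalDegree ≤ k ∧
      ∀ᵐ x ∂(volume.restrict (convexHull ℝ (t : Set (EuclideanSpace ℝ (Fin d))))),
        v x = MvPolynomial.eval (fun i => x i) P

/-- `u_h ∈ V_h` solves the Galerkin equations. -/
def IsGalerkinSolution {d : ℕ} (Ω : Set (EuclideanSpace ℝ (Fin d)))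
    (D : EuclideanSpace ℝ (Fin d) → Matrix (Fin d) (Fin d) ℝ)
    (b : EuclideanSpace ℝ (Fin d) → ℝ → ℝ) (f : EuclideanSpace ℝ (Fin d) → ℝ)
    (T : Geometry.SimplicialComplex ℝ (EuclideanSpace ℝ (Fin d))) (k : ℕ)
    (uh : EuclideanSpace ℝ (Fin d) → ℝ) : Prop :=
  MemFE Ω T k uh ∧ ∀ v, MemFE Ω T k v → SatisfiesWeakEq Ω D b f uh v

end Semilinear

/-!
The difference of the nonlinear terms is controlled by a local Lipschitz estimate, Hölder's
inequality, the Sobolev embedding and an energy estimate.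

* Integrating the bound on `∂_ξ^n b` successively down to `∂_ξ b`, with the bounds on the lower
  derivatives at `ξ = 0`, gives `|b(x, s) - b(x, t)| ≤ B (1 + |s| + |t|)^(n-1) |s - t|` for almost
  every `x` (`HasGrowth.exists_abs_sub_le`).
* Hölder's inequality with `n + 1` factors in `L^{n+1}` (`lintegral_pow_mul_mul_le`) bounds
  `∫ |b(u) - b(u_h)| |v|` by
  `B ‖1 + |u| + |u_h|‖_{n+1}^(n-1) ‖u - u_h‖_{n+1} ‖v‖_{n+1}`.
* The restriction on `n` says that `n + 1` does not exceed the Sobolev exponent, so `L^{n+1}` norms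
  of functions in `H¹₀(Ω)` are bounded by `L²` norms of their gradients
  (`exists_eLpNorm_le_gradNorm`, deduced by density from the Gagliardo-Nirenberg-Sobolev inequality).
* Both `u` and `u_h` may be tested against themselves. As `b(x, t) t ≥ 0`, this bounds `‖∇u‖` and
  `‖∇u_h‖` by `C ‖f‖ / m` (`gradNorm_le_of_satisfiesWeakEq`). Apart from membership in `H¹₀(Ω)`, this
  is all that is used of the finite element space, so neither the mesh nor the degree enters the
  constant.
-/

namespace Semilinear

section

/-! ### Growth of the nonlinearity -/

theorem abs_sub_le_of_abs_deriv_le {g : ℝ → ℝ} (hg : Differentiable ℝ g) {C r : ℝ}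
    (hC : ∀ t, |t| ≤ r → |deriv g t| ≤ C) {s t : ℝ} (hs : |s| ≤ r) (ht : |t| ≤ r) :
    |g s - g t| ≤ C * |s - t| :=
  (convex_Icc (-r) r).norm_image_sub_le_of_norm_deriv_le (fun x _ => hg x)
    (fun x hx => hC x (abs_le.2 hx)) (abs_le.1 ht) (abs_le.1 hs)

/-- If the `n`-th derivative is bounded and the lower ones are bounded at `0`, then the derivative
of order `n - j` has polynomial growth of degree `j`. -/
theorem abs_iteratedDeriv_sub_le {g : ℝ → ℝ} (hg : ContDiff ℝ ∞ g) {n : ℕ} {B : ℝ} (hB : 0 ≤ B)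
    (hn : ∀ ξ, |iteratedDeriv n g ξ| ≤ B)
    (h0 : ∀ k, 1 ≤ k → k < n → |iteratedDeriv k g 0| ≤ B) (j : ℕ) (hj : j < n) (ξ : ℝ) :
    |iteratedDeriv (n - j) g ξ| ≤ (j + 1) * B * (1 + |ξ|) ^ j := by
  induction j generalizing ξ with
  | zero => simpa using hn ξ
  | succ j ih =>
    have hs : n - j = n - (j + 1) + 1 := by omega
    have hd : Differentiable ℝ (iteratedDeriv (n - (j + 1)) g) :=
      hg.differentiable_iteratedDeriv _ (WithTop.coe_lt_coe.2 (ENat.natCast_lt_top _))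
    have h1 : |iteratedDeriv (n - (j + 1)) g ξ - iteratedDeriv (n - (j + 1)) g 0|
        ≤ (j + 1) * B * (1 + |ξ|) ^ j * |ξ - 0| := by
      refine abs_sub_le_of_abs_deriv_le hd (r := |ξ|) (fun t ht => ?_) le_rfl (by simp)
      rw [← iteratedDeriv_succ, ← hs]
      exact (ih (by omega) t).trans (by gcongr)
    have h2 := h0 (n - (j + 1)) (by omega) (by omega)
    have h3 := abs_sub_abs_le_abs_sub (iteratedDeriv (n - (j + 1)) g ξ)
      (iteratedDeriv (n - (j + 1)) g 0)
    have h4 : 1 ≤ (1 + |ξ|) ^ (j + 1) := one_le_pow₀ (by linarith [abs_nonneg ξ])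
    have h5 : (j + 1) * B * (1 + |ξ|) ^ j * |ξ| ≤ (j + 1) * B * (1 + |ξ|) ^ (j + 1) := by
      rw [pow_succ, ← mul_assoc]
      gcongr
      linarith
    rw [sub_zero] at h1
    push_cast
    nlinarith [mul_le_mul_of_nonneg_left h4 hB]

theorem abs_sub_le_of_iteratedDeriv_bound {g : ℝ → ℝ} (hg : ContDiff ℝ ∞ g) {n : ℕ} (hn1 : 1 ≤ n)
    {B : ℝ} (hB : 0 ≤ B) (hn : ∀ ξ, |iteratedDeriv n g ξ| ≤ B)
    (h0 : ∀ k, 1 ≤ k → k < n → |iteratedDeriv k g 0| ≤ B) (s t : ℝ) :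
    |g s - g t| ≤ n * B * (1 + |s| + |t|) ^ (n - 1) * |s - t| := by
  refine abs_sub_le_of_abs_deriv_le (hg.differentiable (by simp)) (r := |s| + |t|)
    (fun ξ hξ => ?_) (by linarith [abs_nonneg t]) (by linarith [abs_nonneg s])
  have h := abs_iteratedDeriv_sub_le hg hB hn h0 (n - 1) (by omega) ξ
  rw [show n - (n - 1) = 1 by omega, iteratedDeriv_one, Nat.cast_sub hn1, Nat.cast_one,
    sub_add_cancel] at h
  refine h.trans ?_
  have : 1 + |ξ| ≤ 1 + |s| + |t| := by linarith
  gcongr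

variable {d : ℕ} {Ω : Set (EuclideanSpace ℝ (Fin d))} {b : EuclideanSpace ℝ (Fin d) → ℝ → ℝ}

/-- The growth condition makes `b(x, ·)` locally Lipschitz, with a constant of polynomial growth of
degree `n - 1` that does not depend on `x`. -/
theorem HasGrowth.exists_abs_sub_le (hΩ : IsOpen Ω) (hb : IsMonotoneNonlinearity Ω b)
    {n : ℕ} (hn : 1 ≤ n) (h : HasGrowth Ω b n) :
    ∃ B : ℝ, 0 ≤ B ∧ ∀ᵐ x ∂(volume.restrict Ω), ∀ s t : ℝ,
      |b x s - b x t| ≤ B * (1 + |s| + |t|) ^ (n - 1) * |s - t| := by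
  obtain ⟨K, hK, hKb⟩ := h.top_bound
  have hl : ∀ k : ℕ, ∃ B : ℝ, 1 ≤ k → k < n →
      ∀ᵐ x ∂(volume.restrict Ω), |iteratedDeriv k (b x) 0| ≤ B := by
    intro k
    by_cases hk : 1 ≤ k ∧ k < n
    · obtain ⟨B, hB⟩ := h.lower_bound k hk.1 hk.2
      exact ⟨B, fun _ _ => hB⟩
    · exact ⟨0, fun h1 h2 => absurd ⟨h1, h2⟩ hk⟩
  choose A hA using hl
  set B := K + ∑ k ∈ Finset.range n, |A k| with hBdef
  have hB : 0 ≤ B := by positivity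
  refine ⟨n * B, by positivity, ?_⟩
  have hall : ∀ᵐ x ∂(volume.restrict Ω), ∀ k : ℕ, 1 ≤ k → k < n →
      |iteratedDeriv k (b x) 0| ≤ A k := by
    simp only [ae_all_iff]
    exact hA
  filter_upwards [hall, ae_restrict_mem hΩ.measurableSet] with x hx hxΩ s t
  refine abs_sub_le_of_iteratedDeriv_bound (hb.contDiff x hxΩ) hn hB (fun ξ => ?_)
    (fun k h1 h2 => ?_) s t
  · have : 0 ≤ ∑ k ∈ Finset.range n, |A k| := by positivity
    linarith [hKb x hxΩ ξ]
  · have := Finset.single_le_sum (f := fun k => |A k|) (fun i _ => abs_nonneg _)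
      (Finset.mem_range.2 h2)
    linarith [hx k h1 h2, le_abs_self (A k)]

/-! ### Measurability and Hölder's inequality -/

/-- Composition with a Carathéodory function preserves measurability. -/
theorem aemeasurable_caratheodory {α : Type*} [MeasurableSpace α] {μ : Measure α}
    {b : α → ℝ → ℝ} (hb : ∀ ξ, AEMeasurable (fun x => b x ξ) μ)
    (hc : ∀ᵐ x ∂μ, Continuous (b x)) {u : α → ℝ} (hu : AEMeasurable u μ) :
    AEMeasurable (fun x => b x (u x)) μ := by
  have hsm := hu.measurable_mk.stronglyMeasurable
  refine aemeasurable_of_tendsto_metrizable_ae Filter.atTop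
    (f := fun k x => b x (hsm.approx k x)) (fun k => ?_) ?_
  · -- on each of its finitely many level sets, a simple function is constant
    let s := hsm.approx k
    have he : (fun x => b x (s x))
        = fun x => ∑ y ∈ s.range, (s ⁻¹' {y}).indicator (fun x => b x y) x := by
      ext x
      rw [Finset.sum_eq_single (s x)]
      · simp
      · intro y _ hy
        simp [Set.indicator_of_notMem, Ne.symm hy]
      · intro h
        exact absurd (s.mem_range_self x) h
    rw [he]
    exact Finset.aemeasurable_fun_sum _ fun y _ => (hb y).indicator (s.measurableSet_fiber y)
  · filter_upwards [hc, hu.ae_eq_mk] with x hx hux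
    rw [hux]
    exact (hx.tendsto _).comp (hsm.tendsto_approx x)

theorem lintegral_rpow_enorm_eq {α : Type*} [MeasurableSpace α] {μ : Measure α} (g : α → ℝ)
    (k : ℕ) : (∫⁻ x, ‖g x‖ₑ ^ ((k : ℝ) + 2) ∂μ) ^ (1 / ((k : ℝ) + 2))
      = eLpNorm g (k + 2 : ℕ) μ := by
  have h : ((k + 2 : ℕ) : ENNReal).toReal = (k : ℝ) + 2 := by
    rw [ENNReal.toReal_natCast]
    push_cast
    rfl
  rw [eLpNorm_eq_lintegral_rpow_enorm_toReal (by simp) (by simp), h]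

/-- Hölder's inequality for a product of `k + 2` factors, all but two of which coincide. -/
theorem lintegral_pow_mul_mul_le {α : Type*} [MeasurableSpace α] {μ : Measure α} {g w v : α → ℝ}
    (hg : AEMeasurable g μ) (hw : AEMeasurable w μ) (hv : AEMeasurable v μ) (k : ℕ) :
    ∫⁻ x, ‖g x‖ₑ ^ k * ‖w x‖ₑ * ‖v x‖ₑ ∂μ ≤
      eLpNorm g (k + 2 : ℕ) μ ^ k * eLpNorm w (k + 2 : ℕ) μ * eLpNorm v (k + 2 : ℕ) μ := by
  have hk : (0 : ℝ) < k + 2 := by positivity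
  have h := ENNReal.lintegral_prod_norm_pow_le (μ := μ) Finset.univ
    (f := ![fun x => ‖g x‖ₑ ^ ((k : ℝ) + 2), fun x => ‖w x‖ₑ ^ ((k : ℝ) + 2),
      fun x => ‖v x‖ₑ ^ ((k : ℝ) + 2)])
    (p := ![1 / ((k : ℝ) + 2) * k, 1 / ((k : ℝ) + 2), 1 / ((k : ℝ) + 2)])
    (by
      intro i _
      fin_cases i
      · exact hg.enorm.pow_const _
      · exact hw.enorm.pow_const _
      · exact hv.enorm.pow_const _)
    (by simp only [Fin.sum_univ_three, Matrix.cons_val]; field_simp; ring)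
    (by intro i _; fin_cases i <;> simp <;> positivity)
  simp only [Fin.prod_univ_three, Matrix.cons_val] at h
  rw [ENNReal.rpow_mul, lintegral_rpow_enorm_eq, lintegral_rpow_enorm_eq,
    lintegral_rpow_enorm_eq, ENNReal.rpow_natCast] at h
  refine le_trans (le_of_eq (lintegral_congr fun x => ?_)) h
  have e : ∀ z : ENNReal, (z ^ ((k : ℝ) + 2)) ^ (1 / ((k : ℝ) + 2)) = z := fun z => by
    rw [← ENNReal.rpow_mul, mul_one_div_cancel hk.ne', ENNReal.rpow_one]
  rw [ENNReal.rpow_mul, e, e, e, ENNReal.rpow_natCast]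

end

section

/-! ### Weak gradients and the space `H¹₀` -/

variable {d : ℕ} {Ω : Set (EuclideanSpace ℝ (Fin d))}
  {u v φ : EuclideanSpace ℝ (Fin d) → ℝ}
  {G H : EuclideanSpace ℝ (Fin d) → EuclideanSpace ℝ (Fin d)}

theorem MemH1.hasWeakGradient (hu : MemH1 Ω u) : HasWeakGradient Ω u (weakGrad Ω u) := by
  have h : ∃ G, HasWeakGradient Ω u G := hu.2.imp fun _ h => h.1
  rw [weakGrad, dif_pos h]
  exact h.choose_spec

theorem MemH1.memLp_weakGrad (hΩ : IsOpen Ω) (hu : MemH1 Ω u) :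
    MemLp (weakGrad Ω u) 2 (volume.restrict Ω) := by
  obtain ⟨G, hG, hG2⟩ := hu.2
  exact hG2.ae_eq (hG.ae_eq hΩ hu.hasWeakGradient)

theorem IsTestFunction.sub (hu : IsTestFunction Ω u) (hv : IsTestFunction Ω v) :
    IsTestFunction Ω (fun x => u x - v x) := by
  refine ⟨hu.1.sub hv.1, hu.2.1.sub hv.2.1, ?_⟩
  exact (tsupport_sub u v).trans (Set.union_subset hu.2.2 hv.2.2)

theorem norm_gradient (φ : EuclideanSpace ℝ (Fin d) → ℝ) (x : EuclideanSpace ℝ (Fin d)) :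
    ‖gradient φ x‖ = ‖fderiv ℝ φ x‖ := by
  rw [gradient, LinearIsometryEquiv.norm_map]

theorem gradient_eq_zero_of_notMem_tsupport {x : EuclideanSpace ℝ (Fin d)}
    (hx : x ∉ tsupport φ) : gradient φ x = 0 := by
  rw [← norm_eq_zero, norm_gradient, norm_eq_zero]
  exact image_eq_zero_of_notMem_tsupport fun h => hx (tsupport_fderiv_subset ℝ h)

theorem gradient_sub (hu : Differentiable ℝ u) (hv : Differentiable ℝ v)
    (x : EuclideanSpace ℝ (Fin d)) :
    gradient (fun x => u x - v x) x = gradient u x - gradient v x := by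
  simp only [gradient, fderiv_fun_sub (hu x) (hv x), map_sub]

theorem IsTestFunction.continuous_gradient (hφ : IsTestFunction Ω φ) :
    Continuous (gradient φ) :=
  (LinearIsometryEquiv.continuous _).comp (hφ.1.continuous_fderiv (by simp))

theorem IsTestFunction.differentiable (hφ : IsTestFunction Ω φ) : Differentiable ℝ φ :=
  hφ.1.differentiable (by simp)

theorem HasWeakGradient.sub (hu : HasWeakGradient Ω u G) (hv : HasWeakGradient Ω v H)
    (hΩ : IsOpen Ω) :
    HasWeakGradient Ω (fun x => u x - v x) (fun x => G x - H x) := by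
  refine ⟨hu.1.sub hv.1, hu.2.sub hv.2, fun φ hφ => ?_⟩
  have hi : ∀ {E : Type} [NormedAddCommGroup E] [NormedSpace ℝ E]
      {F : EuclideanSpace ℝ (Fin d) → E}, LocallyIntegrableOn F Ω volume →
      IntegrableOn (fun x => φ x • F x) Ω volume := by
    intro E _ _ F hF
    refine ((hF.integrableOn_compact_subset hφ.2.2 hφ.2.1).continuousOn_smul
      hφ.1.continuous.continuousOn hφ.2.1).of_forall_sdiff_eq_zero hΩ.measurableSet ?_
    intro x hx
    simp [image_eq_zero_of_notMem_tsupport hx.2]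
  have hg : ∀ {w : EuclideanSpace ℝ (Fin d) → ℝ}, LocallyIntegrableOn w Ω volume →
      IntegrableOn (fun x => w x • gradient φ x) Ω volume := by
    intro w hw
    refine ((hw.integrableOn_compact_subset hφ.2.2 hφ.2.1).smul_continuousOn
      hφ.continuous_gradient.continuousOn hφ.2.1).of_forall_sdiff_eq_zero hΩ.measurableSet ?_
    intro x hx
    simp [gradient_eq_zero_of_notMem_tsupport hx.2]
  simp only [sub_smul, smul_sub]
  rw [integral_sub (hg hu.1) (hg hv.1), integral_sub (hi hu.2) (hi hv.2), hu.3 φ hφ, hv.3 φ hφ]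
  abel

theorem weakGrad_sub_ae (hΩ : IsOpen Ω) (hu : MemH1 Ω u) (hv : MemH1 Ω v) :
    weakGrad Ω (fun x => u x - v x) =ᵐ[volume.restrict Ω]
      fun x => weakGrad Ω u x - weakGrad Ω v x := by
  have h := hu.hasWeakGradient.sub hv.hasWeakGradient hΩ
  have h1 : MemH1 Ω (fun x => u x - v x) :=
    ⟨hu.1.sub hv.1, _, h, (hu.memLp_weakGrad hΩ).sub (hv.memLp_weakGrad hΩ)⟩
  exact h1.hasWeakGradient.ae_eq hΩ h

theorem MemH10.sub (hΩ : IsOpen Ω) (hu : MemH10 Ω u) (hv : MemH10 Ω v) :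
    MemH10 Ω (fun x => u x - v x) := by
  have hu2 := hu.1.memLp_weakGrad hΩ
  have hv2 := hv.1.memLp_weakGrad hΩ
  refine ⟨⟨hu.1.1.sub hv.1.1, _, hu.1.hasWeakGradient.sub hv.1.hasWeakGradient hΩ,
    hu2.sub hv2⟩, fun ε hε => ?_⟩
  obtain ⟨φ, hφ, hφε⟩ := hu.2 (ε / 2) (ENNReal.half_pos hε.ne')
  obtain ⟨ψ, hψ, hψε⟩ := hv.2 (ε / 2) (ENNReal.half_pos hε.ne')
  refine ⟨fun x => φ x - ψ x, hφ.sub hψ, ?_⟩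
  have h1 : eLpNorm (fun x => u x - v x - (φ x - ψ x)) 2 (volume.restrict Ω) ≤
      eLpNorm (fun x => u x - φ x) 2 (volume.restrict Ω) +
        eLpNorm (fun x => v x - ψ x) 2 (volume.restrict Ω) := by
    rw [show (fun x => u x - v x - (φ x - ψ x)) = (fun x => u x - φ x) - fun x => v x - ψ x from
      funext fun x => sub_sub_sub_comm _ _ _ _]
    exact eLpNorm_sub_le
      (hu.1.1.aestronglyMeasurable.sub hφ.1.continuous.aestronglyMeasurable)
      (hv.1.1.aestronglyMeasurable.sub hψ.1.continuous.aestronglyMeasurable) (by norm_num)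
  have h2 : eLpNorm (fun x => weakGrad Ω (fun x => u x - v x) x
        - gradient (fun x => φ x - ψ x) x) 2 (volume.restrict Ω) ≤
      eLpNorm (fun x => weakGrad Ω u x - gradient φ x) 2 (volume.restrict Ω) +
        eLpNorm (fun x => weakGrad Ω v x - gradient ψ x) 2 (volume.restrict Ω) := by
    have e : (fun x => weakGrad Ω (fun x => u x - v x) x - gradient (fun x => φ x - ψ x) x)
        =ᵐ[volume.restrict Ω] fun x => (weakGrad Ω u x - gradient φ x)
          - (weakGrad Ω v x - gradient ψ x) := by
      filter_upwards [weakGrad_sub_ae hΩ hu.1 hv.1] with x hx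
      rw [hx, gradient_sub hφ.differentiable hψ.differentiable, sub_sub_sub_comm]
    rw [eLpNorm_congr_ae e]
    exact eLpNorm_sub_le
      (hu2.aestronglyMeasurable.sub hφ.continuous_gradient.aestronglyMeasurable)
      (hv2.aestronglyMeasurable.sub hψ.continuous_gradient.aestronglyMeasurable) (by norm_num)
  calc _ ≤ _ := add_le_add h1 h2
    _ = _ := add_add_add_comm _ _ _ _
    _ < ε / 2 + ε / 2 := ENNReal.add_lt_add hφε hψε
    _ = ε := ENNReal.add_halves ε

/-! ### The Sobolev inequality -/

/-- The Sobolev inequality for test functions, with an exponent `n + 1` that is subcritical or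
critical. In dimension two the gradient exponent `2` is not admissible in the
Gagliardo-Nirenberg-Sobolev inequality; that inequality is used with the exponent
`p = 2(n+1)/(n+3) < 2`, for which `n + 1` is the Sobolev exponent, and Hölder's inequality on the
bounded set `Ω` goes from `p` to `2`. -/
theorem exists_eLpNorm_le_of_isTestFunction (hd : d = 2 ∨ d = 3) (hΩb : Bornology.IsBounded Ω)
    {n : ℕ} (hn : 1 ≤ n) (hn' : d = 3 → n ≤ 5) :
    ∃ C : NNReal, ∀ φ : EuclideanSpace ℝ (Fin d) → ℝ, IsTestFunction Ω φ →
      eLpNorm φ (n + 1 : ℕ) (volume.restrict Ω) ≤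
        C * eLpNorm (gradient φ) 2 (volume.restrict Ω) := by
  obtain ⟨p, hp1, hp2, hpd, hpn⟩ : ∃ p : NNReal, 1 ≤ p ∧ p ≤ 2 ∧ p < d ∧
      (p : ℝ)⁻¹ - (d : ℝ)⁻¹ ≤ ((n + 1 : ℕ) : ℝ)⁻¹ := by
    have hn1 : (1 : ℝ) ≤ n := mod_cast hn
    rcases hd with rfl | rfl
    · refine ⟨2 * (n + 1) / (n + 3), ?_, ?_, ?_, ?_⟩
      · rw [← NNReal.coe_le_coe]; push_cast
        rw [le_div_iff₀ (by positivity)]; linarith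
      · rw [← NNReal.coe_le_coe]; push_cast
        rw [div_le_iff₀ (by positivity)]; linarith
      · rw [← NNReal.coe_lt_coe]; push_cast
        rw [div_lt_iff₀ (by positivity)]; linarith
      · push_cast
        apply le_of_eq
        field_simp
        ring
    · refine ⟨2, by norm_num, le_rfl, by norm_num, ?_⟩
      have : ((n + 1 : ℕ) : ℝ) ≤ 6 := by exact_mod_cast Nat.succ_le_succ (hn' rfl)
      calc ((2 : NNReal) : ℝ)⁻¹ - ((3 : ℕ) : ℝ)⁻¹ = 6⁻¹ := by norm_num
        _ ≤ _ := by gcongr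
  have hfin : volume Ω ^ (1 / (p : ENNReal).toReal - 1 / (2 : ENNReal).toReal) ≠ ⊤ := by
    refine ENNReal.rpow_ne_top_of_nonneg ?_ hΩb.measure_lt_top.ne
    rw [sub_nonneg]
    simp only [ENNReal.toReal_ofNat, ENNReal.coe_toReal]
    gcongr
    exact_mod_cast hp2
  refine ⟨eLpNormLESNormFDerivOfLeConst ℝ (volume : Measure (EuclideanSpace ℝ (Fin d))) Ω p
    ((n + 1 : ℕ) : NNReal) * (volume Ω ^ (1 / (p : ENNReal).toReal
      - 1 / (2 : ENNReal).toReal)).toNNReal, fun φ hφ => ?_⟩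
  have hs : Function.support φ ⊆ Ω := (subset_tsupport φ).trans hφ.2.2
  have h1 := eLpNorm_le_eLpNorm_fderiv_of_le
    (volume : Measure (EuclideanSpace ℝ (Fin d))) (u := φ) (s := Ω) (p := p)
    (q := ((n + 1 : ℕ) : NNReal)) (hφ.1.of_le (by simp)) hs hp1
    (by simpa using hpd) (by simpa using hpn) hΩb
  have hs' : Function.support (gradient φ) ⊆ Ω := fun x hx => by
    by_contra hxΩ
    exact hx (gradient_eq_zero_of_notMem_tsupport fun h => hxΩ (hφ.2.2 h))
  have h2 : eLpNorm (fderiv ℝ φ) p volume ≤ eLpNorm (gradient φ) 2 (volume.restrict Ω) *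
      volume Ω ^ (1 / (p : ENNReal).toReal - 1 / (2 : ENNReal).toReal) := by
    have e1 : eLpNorm (gradient φ) p volume = eLpNorm (fderiv ℝ φ) p volume :=
      eLpNorm_congr_norm_ae (ae_of_all _ (norm_gradient φ))
    rw [← e1, ← eLpNorm_restrict_eq_of_support_subset hs']
    have := eLpNorm_le_eLpNorm_mul_rpow_measure_univ (μ := volume.restrict Ω)
      (f := gradient φ) (p := p) (q := 2) (mod_cast hp2)
      hφ.continuous_gradient.aestronglyMeasurable
    simpa only [Measure.restrict_apply_univ] using this
  rw [eLpNorm_restrict_eq_of_support_subset hs, ENNReal.coe_mul, ENNReal.coe_toNNReal hfin]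
  rw [ENNReal.coe_natCast] at h1
  calc _ ≤ _ := h1
    _ ≤ _ := mul_le_mul_right h2 _
    _ = _ := by rw [← mul_assoc, mul_right_comm]

theorem ofReal_gradNorm (hΩ : IsOpen Ω) (hu : MemH1 Ω u) :
    ENNReal.ofReal (gradNorm Ω u) = eLpNorm (weakGrad Ω u) 2 (volume.restrict Ω) :=
  ENNReal.ofReal_toReal (hu.memLp_weakGrad hΩ).2.ne

/-- The embedding of `H¹₀(Ω)` into `L^{n+1}(Ω)`; with `n = 1` this is Poincaré's inequality. The
bound passes from the test functions to their limits by Fatou's lemma. -/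
theorem exists_eLpNorm_le_gradNorm (hd : d = 2 ∨ d = 3) (hΩ : IsOpen Ω)
    (hΩb : Bornology.IsBounded Ω) {n : ℕ} (hn : 1 ≤ n) (hn' : d = 3 → n ≤ 5) :
    ∃ C : NNReal, ∀ u : EuclideanSpace ℝ (Fin d) → ℝ, MemH10 Ω u →
      eLpNorm u (n + 1 : ℕ) (volume.restrict Ω) ≤ ENNReal.ofReal (C * gradNorm Ω u) := by
  obtain ⟨C, hC⟩ := exists_eLpNorm_le_of_isTestFunction hd hΩb hn hn'
  refine ⟨C, fun u hu => ?_⟩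
  have hg := hu.1.memLp_weakGrad hΩ
  rw [ENNReal.ofReal_mul C.coe_nonneg, ofReal_gradNorm hΩ hu.1, ENNReal.ofReal_coe_nnreal]
  have hε : ∀ j : ℕ, (0 : ENNReal) < (j + 1 : ENNReal)⁻¹ := fun j => by simp
  choose φ hφ hφε using fun j : ℕ => hu.2 _ (hε j)
  have hlim : Filter.Tendsto (fun j : ℕ => ((j : ENNReal) + 1)⁻¹) Filter.atTop (nhds 0) := by
    have := ENNReal.tendsto_inv_nat_nhds_zero.comp (Filter.tendsto_add_atTop_nat 1)
    simpa [Function.comp_def] using this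
  have hu_lim : Filter.Tendsto (fun j => eLpNorm (φ j - u) 2 (volume.restrict Ω))
      Filter.atTop (nhds 0) := by
    refine tendsto_of_tendsto_of_tendsto_of_le_of_le tendsto_const_nhds hlim
      (fun _ => zero_le) fun j => ?_
    rw [eLpNorm_sub_comm]
    exact (le_self_add.trans (hφε j).le)
  have hmeas := tendstoInMeasure_of_tendsto_eLpNorm (by norm_num)
    (fun j => (hφ j).1.continuous.aestronglyMeasurable) hu.1.1.aestronglyMeasurable hu_lim
  obtain ⟨ns, hns, hae⟩ := hmeas.exists_seq_tendsto_ae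
  refine (Lp.eLpNorm_lim_le_liminf_eLpNorm
    (fun j => (hφ (ns j)).1.continuous.aestronglyMeasurable) u hae).trans ?_
  have hb : ∀ j, eLpNorm (φ (ns j)) (n + 1 : ℕ) (volume.restrict Ω) ≤
      C * (eLpNorm (weakGrad Ω u) 2 (volume.restrict Ω) + ((ns j : ENNReal) + 1)⁻¹) := by
    intro j
    refine (hC _ (hφ (ns j))).trans (mul_le_mul_right ?_ _)
    have hgm := (hφ (ns j)).continuous_gradient.aestronglyMeasurable (μ := volume.restrict Ω)
    calc eLpNorm (gradient (φ (ns j))) 2 (volume.restrict Ω)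
        = eLpNorm (weakGrad Ω u - (weakGrad Ω u - gradient (φ (ns j)))) 2
            (volume.restrict Ω) := by rw [sub_sub_cancel]
      _ ≤ _ := eLpNorm_sub_le hg.1 (hg.1.sub hgm) (by norm_num)
      _ ≤ _ := add_le_add_right (le_add_self.trans (hφε (ns j)).le) _
  have hlim2 : Filter.Tendsto (fun j => (C : ENNReal) *
      (eLpNorm (weakGrad Ω u) 2 (volume.restrict Ω) + ((ns j : ENNReal) + 1)⁻¹))
      Filter.atTop (nhds (C * (eLpNorm (weakGrad Ω u) 2 (volume.restrict Ω) + 0))) :=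
    ENNReal.Tendsto.const_mul ((hlim.comp hns.tendsto_atTop).const_add _)
      (Or.inr ENNReal.coe_ne_top)
  rw [add_zero] at hlim2
  rw [← hlim2.liminf_eq]
  exact Filter.liminf_le_liminf (Filter.Eventually.of_forall hb)

end

section

/-! ### The a priori bound -/

theorem integral_le_of_lintegral_enorm_le {α : Type*} [MeasurableSpace α] {μ : Measure α}
    {F : α → ℝ} {R : ℝ} (hR : 0 ≤ R) (h : ∫⁻ x, ‖F x‖ₑ ∂μ ≤ ENNReal.ofReal R) :
    ∫ x, F x ∂μ ≤ R := by
  have h1 := (enorm_integral_le_lintegral_enorm F).trans h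
  rw [← ofReal_norm, ENNReal.ofReal_le_ofReal_iff hR] at h1
  exact (le_abs_self _).trans h1

variable {d : ℕ} {Ω : Set (EuclideanSpace ℝ (Fin d))}
  {D : EuclideanSpace ℝ (Fin d) → Matrix (Fin d) (Fin d) ℝ}
  {b : EuclideanSpace ℝ (Fin d) → ℝ → ℝ} {f w : EuclideanSpace ℝ (Fin d) → ℝ} {m M : ℝ}

theorem gradNorm_nonneg : 0 ≤ gradNorm Ω w := ENNReal.toReal_nonneg

theorem sq_gradNorm (hΩ : IsOpen Ω) (hw : MemH1 Ω w) :
    gradNorm Ω w ^ 2 = ∫ x in Ω, ‖weakGrad Ω w x‖ ^ 2 := by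
  rw [gradNorm, (hw.memLp_weakGrad hΩ).eLpNorm_eq_integral_rpow_norm (by simp) (by simp),
    ENNReal.toReal_ofReal (by positivity), ENNReal.toReal_ofNat, ← Real.rpow_mul_natCast
      (integral_nonneg fun x => by positivity)]
  simp

/-- Coercivity of the energy form. The upper bound on `D` is used for the integrability of
`D ∇w · ∇w`, without which the integral in the energy form would be zero by convention. -/
theorem mul_sq_gradNorm_le_energyForm (hΩ : IsOpen Ω) (hD : IsElliptic Ω D m M) (hm : 0 < m)
    (hw : MemH1 Ω w) : m * gradNorm Ω w ^ 2 ≤ energyForm Ω D w w := by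
  have hG := hw.memLp_weakGrad hΩ
  have hG2 : Integrable (fun x => ‖weakGrad Ω w x‖ ^ 2) (volume.restrict Ω) :=
    hG.integrable_norm_pow (by norm_num)
  have hGi : ∀ i, AEMeasurable (fun x => weakGrad Ω w x i) (volume.restrict Ω) := fun i =>
    (EuclideanSpace.proj i : EuclideanSpace ℝ (Fin d) →L[ℝ] ℝ).continuous.measurable.comp_aemeasurable
      hG.aestronglyMeasurable.aemeasurable
  have hmeas : AEMeasurable
      (fun x => (D x *ᵥ (weakGrad Ω w x).ofLp) ⬝ᵥ (weakGrad Ω w x).ofLp) (volume.restrict Ω) := by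
    simp only [dotProduct, Matrix.mulVec]
    exact Finset.aemeasurable_fun_sum _ fun i _ => (Finset.aemeasurable_fun_sum _ fun j _ =>
      (hD.memLp_top i j).aestronglyMeasurable.aemeasurable.mul (hGi j)).mul (hGi i)
  have hint : Integrable
      (fun x => (D x *ᵥ (weakGrad Ω w x).ofLp) ⬝ᵥ (weakGrad Ω w x).ofLp)
      (volume.restrict Ω) := by
    refine (hG2.const_mul M).mono' hmeas.aestronglyMeasurable ?_
    filter_upwards [hD.bounds] with x hx
    have h := hx (weakGrad Ω w x)
    rw [dotProduct_comm] at h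
    rw [Real.norm_of_nonneg (le_trans (by positivity) h.1)]
    exact h.2
  rw [sq_gradNorm hΩ hw, energyForm, ← integral_const_mul]
  refine integral_mono_ae (hG2.const_mul m) hint ?_
  filter_upwards [hD.bounds] with x hx
  have h := hx (weakGrad Ω w x)
  rw [dotProduct_comm] at h
  exact h.1

theorem IsMonotoneNonlinearity.mul_self_nonneg (hb : IsMonotoneNonlinearity Ω b)
    {x : EuclideanSpace ℝ (Fin d)} (hx : x ∈ Ω) (t : ℝ) : 0 ≤ b x t * t := by
  have hmono : Monotone (b x) :=
    monotone_of_deriv_nonneg ((hb.contDiff x hx).differentiable (by simp)) (hb.deriv_nonneg x hx)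
  rcases le_total 0 t with ht | ht
  · exact mul_nonneg ((hb.map_zero x hx).symm.le.trans (hmono ht)) ht
  · exact mul_nonneg_of_nonpos_of_nonpos ((hmono ht).trans (hb.map_zero x hx).le) ht

/-- A function that may be used as a test function in its own equation is bounded in the energy
norm by the data: the nonlinear term has a sign. -/
theorem gradNorm_le_of_satisfiesWeakEq (hΩ : IsOpen Ω) (hD : IsElliptic Ω D m M) (hm : 0 < m)
    (hb : IsMonotoneNonlinearity Ω b) (hf : MemLp f 2 (volume.restrict Ω)) {C : NNReal}
    (hC : eLpNorm w 2 (volume.restrict Ω) ≤ ENNReal.ofReal (C * gradNorm Ω w))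
    (hw : MemH10 Ω w) (h : SatisfiesWeakEq Ω D b f w w) :
    gradNorm Ω w ≤ (eLpNorm f 2 (volume.restrict Ω)).toReal * C / m := by
  have h1 := mul_sq_gradNorm_le_energyForm hΩ hD hm hw.1
  have h2 : 0 ≤ ∫ x in Ω, b x (w x) * w x := by
    refine integral_nonneg_of_ae ?_
    filter_upwards [ae_restrict_mem hΩ.measurableSet] with x hx
    exact hb.mul_self_nonneg hx _
  have h3 : ∫ x in Ω, f x * w x ≤
      (eLpNorm f 2 (volume.restrict Ω)).toReal * (C * gradNorm Ω w) := by
    have hg0 := gradNorm_nonneg (Ω := Ω) (w := w)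
    refine integral_le_of_lintegral_enorm_le (by positivity) ?_
    have h4 := lintegral_pow_mul_mul_le (μ := volume.restrict Ω) (g := fun _ => 1)
      aemeasurable_const hf.aestronglyMeasurable.aemeasurable
      hw.1.1.aestronglyMeasurable.aemeasurable 0
    simp only [pow_zero, one_mul, zero_add] at h4
    rw [ENNReal.ofReal_mul ENNReal.toReal_nonneg, ENNReal.ofReal_toReal hf.2.ne]
    simp only [enorm_mul]
    exact h4.trans (mul_le_mul_right hC _)
  have h5 := h.2
  rw [le_div_iff₀ hm]
  -- `m ‖∇w‖² ≤ ‖f‖ C ‖∇w‖`; one factor `‖∇w‖` cancels unless it is zero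
  rcases gradNorm_nonneg (Ω := Ω) (w := w).eq_or_lt with h0 | h0
  · rw [← h0]
    simp only [zero_mul]
    positivity
  · refine le_of_mul_le_mul_right ?_ h0
    nlinarith

end

end Semilinear

open Semilinear in
theorem theorem3p3 (d : ℕ) (hd : d = 2 ∨ d = 3)
    (Ω : Set (EuclideanSpace ℝ (Fin d))) (hΩ : IsOpen Ω) (hΩb : Bornology.IsBounded Ω)
    (m : ℝ) (hm : 0 < m)
    (f : EuclideanSpace ℝ (Fin d) → ℝ) (hf : MemLp f 2 (volume.restrict Ω))
    (b : EuclideanSpace ℝ (Fin d) → ℝ → ℝ) (hb : Semilinear.IsMonotoneNonlinearity Ω b)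
    (n : ℕ) (hn : 1 ≤ n) (hn' : 3 ≤ d → (n : ℝ) ≤ ((d : ℝ) + 2) / ((d : ℝ) - 2))
    (hgrowth : Semilinear.HasGrowth Ω b n) :
    ∃ C_L : ℝ,
      ∀ (D : EuclideanSpace ℝ (Fin d) → Matrix (Fin d) (Fin d) ℝ) (M : ℝ), 0 < M →
        Semilinear.IsElliptic Ω D m M →
      ∀ u : EuclideanSpace ℝ (Fin d) → ℝ, Semilinear.IsWeakSolution Ω D b f u →
      ∀ T : Geometry.SimplicialComplex ℝ (EuclideanSpace ℝ (Fin d)),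
        Semilinear.IsTriangulation Ω T →
      ∀ k : ℕ, 1 ≤ k →
      ∀ uh : EuclideanSpace ℝ (Fin d) → ℝ, Semilinear.IsGalerkinSolution Ω D b f T k uh →
      ∀ v : EuclideanSpace ℝ (Fin d) → ℝ, Semilinear.MemH10 Ω v →
        IntegrableOn (fun x => (b x (u x) - b x (uh x)) * v x) Ω volume ∧
        ∫ x in Ω, (b x (u x) - b x (uh x)) * v x ≤
          C_L * Semilinear.gradNorm Ω (fun x => u x - uh x) * Semilinear.gradNorm Ω v := by
  -- for `d = 2` the hypothesis `hn'` is vacuous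
  have hn5 : d = 3 → n ≤ 5 := by
    rintro rfl
    have := hn' le_rfl
    norm_num at this
    exact_mod_cast this
  obtain ⟨C₂, hC₂⟩ := exists_eLpNorm_le_gradNorm hd hΩ hΩb le_rfl (fun _ => by norm_num)
  obtain ⟨C, hC⟩ := exists_eLpNorm_le_gradNorm hd hΩ hΩb hn hn5
  obtain ⟨B, hB, hbB⟩ := hgrowth.exists_abs_sub_le hΩ hb hn
  obtain ⟨N, rfl⟩ : ∃ N, n = N + 1 := ⟨n - 1, by omega⟩
  simp only [Nat.add_sub_cancel] at hbB
  have : IsFiniteMeasure (volume.restrict Ω) := ⟨by simpa using hΩb.measure_lt_top⟩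
  set μ := volume.restrict Ω with hμ
  set R := (eLpNorm f 2 μ).toReal * C₂ / m with hR
  set L := (eLpNorm (fun _ : EuclideanSpace ℝ (Fin d) => (1 : ℝ)) (N + 1 + 1 : ℕ) μ).toReal
    with hL
  have hR0 : 0 ≤ R := by positivity
  have hL0 : 0 ≤ L := ENNReal.toReal_nonneg
  refine ⟨B * ((L + C * R + C * R) ^ N * C * C), ?_⟩
  intro D M _ hD u hu T _ k _ uh huh v hv
  have huR : gradNorm Ω u ≤ R :=
    gradNorm_le_of_satisfiesWeakEq hΩ hD hm hb hf (hC₂ u hu.1) hu.1 (hu.2 u hu.1)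
  have huhR : gradNorm Ω uh ≤ R :=
    gradNorm_le_of_satisfiesWeakEq hΩ hD hm hb hf (hC₂ uh huh.1.1) huh.1.1 (huh.2 uh huh.1)
  have hw : MemH10 Ω (fun x => u x - uh x) := hu.1.sub hΩ huh.1.1
  have hum := hu.1.1.1.aestronglyMeasurable.aemeasurable
  have huhm := huh.1.1.1.1.aestronglyMeasurable.aemeasurable
  have hvm := hv.1.1.aestronglyMeasurable.aemeasurable
  have hgm : AEMeasurable (fun x => 1 + |u x| + |uh x|) μ :=
    (hum.abs.const_add 1).add huhm.abs
  have hg : eLpNorm (fun x => 1 + |u x| + |uh x|) (N + 1 + 1 : ℕ) μ ≤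
      ENNReal.ofReal (L + C * R + C * R) := by
    have hp : (1 : ENNReal) ≤ (N + 1 + 1 : ℕ) := by exact_mod_cast Nat.le_add_left 1 _
    have e : ∀ z : EuclideanSpace ℝ (Fin d) → ℝ, MemH10 Ω z → gradNorm Ω z ≤ R →
        eLpNorm (fun x => |z x|) (N + 1 + 1 : ℕ) μ ≤ ENNReal.ofReal (C * R) := by
      intro z hz hzR
      rw [eLpNorm_congr_norm_ae (g := z) (ae_of_all _ fun x => by simp)]
      exact (hC z hz).trans (ENNReal.ofReal_le_ofReal (by gcongr))
    rw [ENNReal.ofReal_add (by positivity) (by positivity),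
      ENNReal.ofReal_add hL0 (by positivity)]
    refine (eLpNorm_add_le (f := fun x => 1 + |u x|) (g := fun x => |uh x|)
      (hum.abs.const_add 1).aestronglyMeasurable huhm.abs.aestronglyMeasurable hp).trans
      (add_le_add ((eLpNorm_add_le (f := fun _ => (1 : ℝ)) (g := fun x => |u x|)
        aestronglyMeasurable_const hum.abs.aestronglyMeasurable hp).trans
        (add_le_add ?_ (e u hu.1 huR))) (e uh huh.1.1 huhR))
    rw [hL, ENNReal.ofReal_toReal (memLp_const (1 : ℝ)).2.ne]
  have hG0 := gradNorm_nonneg (Ω := Ω) (w := fun x => u x - uh x)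
  have hGv := gradNorm_nonneg (Ω := Ω) (w := v)
  have key : ∫⁻ x, ‖(b x (u x) - b x (uh x)) * v x‖ₑ ∂μ ≤
      ENNReal.ofReal (B * ((L + C * R + C * R) ^ N * C * C) *
        gradNorm Ω (fun x => u x - uh x) * gradNorm Ω v) := by
    calc ∫⁻ x, ‖(b x (u x) - b x (uh x)) * v x‖ₑ ∂μ
        ≤ ∫⁻ x, ENNReal.ofReal B * (‖1 + |u x| + |uh x|‖ₑ ^ N * ‖u x - uh x‖ₑ * ‖v x‖ₑ) ∂μ := by
          refine lintegral_mono_ae ?_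
          filter_upwards [hbB] with x hx
          rw [← Real.enorm_of_nonneg hB, ← enorm_pow, ← enorm_mul, ← enorm_mul, ← enorm_mul]
          refine enorm_le_iff_norm_le.2 ?_
          simp only [norm_mul, norm_pow, Real.norm_eq_abs]
          rw [abs_of_nonneg hB, abs_of_nonneg (by positivity : 0 ≤ 1 + |u x| + |uh x|),
            ← mul_assoc, ← mul_assoc]
          exact mul_le_mul_of_nonneg_right (hx _ _) (abs_nonneg _)
      _ = ENNReal.ofReal B * ∫⁻ x, ‖1 + |u x| + |uh x|‖ₑ ^ N * ‖u x - uh x‖ₑ * ‖v x‖ₑ ∂μ :=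
          lintegral_const_mul' _ _ ENNReal.ofReal_ne_top
      _ ≤ ENNReal.ofReal B * (ENNReal.ofReal (L + C * R + C * R) ^ N *
            ENNReal.ofReal (C * gradNorm Ω (fun x => u x - uh x)) *
            ENNReal.ofReal (C * gradNorm Ω v)) := by
          refine mul_le_mul_right ((lintegral_pow_mul_mul_le hgm (hum.sub huhm) hvm N).trans ?_) _
          exact mul_le_mul' (mul_le_mul' (pow_le_pow_left' hg N) (hC _ hw)) (hC v hv)
      _ = _ := by
          rw [← ENNReal.ofReal_pow (by positivity), ← ENNReal.ofReal_mul (by positivity),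
            ← ENNReal.ofReal_mul (by positivity), ← ENNReal.ofReal_mul hB]
          congr 1
          ring
  have hc : ∀ᵐ x ∂μ, Continuous (b x) := by
    filter_upwards [ae_restrict_mem hΩ.measurableSet] with x hx
    exact (hb.contDiff x hx).continuous
  refine ⟨⟨(((aemeasurable_caratheodory hb.aemeasurable hc hum).sub
    (aemeasurable_caratheodory hb.aemeasurable hc huhm)).mul hvm).aestronglyMeasurable,
    key.trans_lt ENNReal.ofReal_lt_top⟩, ?_⟩
  exact integral_le_of_lintegral_enorm_le (by positivity) key
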